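/- **Setting.** A boolean function is a family $f=(f_n)_{n\ge 0}$, $f_n:\{0,1\}^n\times\{0,1\}^n\to\{0,1\}$. For $k\ge1$ and $g:\mathbb N\to\mathbb R$, we say $f\in\Sigma^{cc}_k(g(n))$ if there are $s(n)=O(g(n))$ and, for every $n$, maps $A,B$ from ($k$ advice strings of $s(n)$ bits, one $n$-bit vector) to $\{0,1\}$ such that for all $x,y\in\{0,1\}^n$ $$f_n(x,y)=1\iff \exists \ell_1\forall \ell_2\cdots Q\ell_k:\ A(\ell_1,\dots,\ell_k,x)=B(\ell_1,\dots,\ell_k,y)=1,$$ where the quantifiers alternate and range over $\{0,1\}^{s(n)}$; $\Pi^{cc}_k(g(n))$ is defined in the same way with the quantifier $\forall$ first. A network is a finite connected simple graph whose nodes carry inputs from a fixed set, and a distributed language is a set of networks. Nodes have distinct identifiers bounded by a polynomial $N^c$ in the number $N$ of nodes. A language $L$ is in $\Sigma_k(g(n))$ if for every constant $c$ there are a constant radius $r$, a label size $s(N)=O(g(N))$ and a verifier such that, for every network $G$ with $N$ nodes and every such assignment of identifiers, $$G\in L\iff \exists \ell_1\forall \ell_2\cdots Q\ell_k:\ \text{all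 nodes accept},$$ where each $\ell_j$ gives a label of $s(N)$ bits to every node, and each node decides by applying the verifier to its radius-$r$ neighbourhood only (structure, identifiers, inputs and all labels in it). $\Pi_k(g(n))$ is the same with $\forall$ first. $\Lambda_k(g(n))$ is $\Sigma_k(g(n))$ for odd $k$ and $\Pi_k(g(n))$ for even $k$. Let $\varphi$ map every graph on $n$ nodes to a vector in $\{0,1\}^n$, such that isomorphic graphs have the same image and, for all sufficiently large $n$, every $n$-bit vector is attained. Let $L_{f,\varphi}$ be the set of all networks which, for some $n\ge 0$, $t\ge1$ and some graphs $G_A,G_B$ on $n$ nodes, are isomorphic (with inputs) to the following: a path $v_1,\dots,v_{2t+1}$, a copy of $G_A$ all of whose nodes are joined to $v_1$, and a copy of $G_B$ all of whose nodes are joined to $v_{2t+1}$, where the input marks $v_1$ as Alice's node, $v_{2t+1}$ as Bob's node and every other node as ordinary, and where $f_n(\varphi(G_A),\varphi(G_B))=1$. **Theorem.** For every boolean function $f$ there is a distributed language $L_f$, namely $L_f=L_{f,\varphi}$ for some map $\varphi$ as above, such that for every $k\ge1$ and every nondecreasing $g$ with $g(n)=\Omega(\log n)$: if $f\in\Sigma^{cc}_k(g(n))$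 and $k$ is odd, or $f\in\Pi^{cc}_k(g(n))$ and $k\ge2$ is even, then $L_f\in\Lambda_k(g(n))$. -/

import Mathlib

open Filter Asymptotics

/-- Bit strings of length `m`. -/
abbrev BitString (m : ℕ) : Type := Fin m → Bool

/-- The game in which two players alternately choose `k` elements `ℓ 0, …, ℓ (k - 1)` of `α`.
If `proverFirst = true` this is `∃ ℓ 0, ∀ ℓ 1, ∃ ℓ 2, …, P ℓ`, and if `proverFirst = false` it is
`∀ ℓ 0, ∃ ℓ 1, ∀ ℓ 2, …, P ℓ`. -/
def Alternating {α : Type} : (k : ℕ) → (proverFirst : Bool) → ((Fin k → α) → Prop) → Prop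
  | 0, _, P => P Fin.elim0
  | k + 1, true, P =>
      ∃ a : α, Alternating k false fun l => P (Fin.cons (α := fun _ => α) a l)
  | k + 1, false, P =>
      ∀ a : α, Alternating k true fun l => P (Fin.cons (α := fun _ => α) a l)

section CommunicationComplexity

/-- A boolean function on pairs of `n`-bit vectors, for every `n`. -/
abbrev BooleanFunction : Type := (n : ℕ) → BitString n → BitString n → Bool

/-- `f` is decided by Alice and Bob with `k` alternating advice strings, seen by both of them, of
`s n = O(g n)` bits each on inputs of length `n`; `proverFirst` tells who gives the first string.
Messages exchanged by Alice and Bob are part of the advice. -/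
def DecidableCC (proverFirst : Bool) (k : ℕ) (g : ℕ → ℝ) (f : BooleanFunction) : Prop :=
  ∃ s : ℕ → ℕ, (fun n => (s n : ℝ)) =O[atTop] g ∧
    ∃ A B : (n : ℕ) → (Fin k → BitString (s n)) → BitString n → Bool,
      ∀ (n : ℕ) (x y : BitString n),
        Alternating k proverFirst
            (fun l : Fin k → BitString (s n) => A n l x = true ∧ B n l y = true) ↔
          f n x y = true

/-- The class `Σ_k^cc(g(n))`. -/
def SigmaCC (k : ℕ) (g : ℕ → ℝ) : Set BooleanFunction := {f | DecidableCC true k g f}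

/-- The class `Π_k^cc(g(n))`. -/
def PiCC (k : ℕ) (g : ℕ → ℝ) : Set BooleanFunction := {f | DecidableCC false k g f}

end CommunicationComplexity

section LocalDecision

/-- A network: a finite connected simple graph in which every node has an input from `I`. -/
structure Network (I : Type) where
  /-- the number of nodes -/
  size : ℕ
  graph : SimpleGraph (Fin size)
  connected : graph.Connected
  input : Fin size → I

/-- A distributed language: a set of graphs with inputs. -/
abbrev DistributedLanguage (I : Type) : Type := Set (Network I)

/-- What a node gets to know: its own identifier, and for the nodes of its neighborhood, which are
named by their identifiers, the edges between them, their inputs, and their `k` labels. -/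
structure LocalView (I : Type) (k : ℕ) where
  center : ℕ
  nodes : Set (ℕ × I × (Fin k → List Bool))
  edges : Set (ℕ × ℕ)

/-- The view of node `v` at radius `t`, given the identifiers `ident` and the `k` labels `l · u` of
every node `u`, each of `m` bits. -/
def Network.view {I : Type} (G : Network I) (ident : Fin G.size → ℕ) {k m : ℕ}
    (l : Fin k → Fin G.size → BitString m) (t : ℕ) (v : Fin G.size) : LocalView I k where
  center := ident v
  nodes := {p | ∃ u, G.graph.dist v u ≤ t ∧
    p = (ident u, G.input u, fun j => List.ofFn (l j u))}
  edges := {p | ∃ u w, G.graph.dist v u ≤ t ∧ G.graph.dist v w ≤ t ∧ G.graph.Adj u w ∧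
    p = (ident u, ident w)}

/-- The language `L` is decided with `k` alternating assignments of labels to the nodes, each label
having `s N = O(g N)` bits, where `N` is the number of nodes. The identifiers are distinct and at
most `N ^ c`, where `c` is an arbitrary constant. The radius `t` is constant, and the verifier
depends on nothing but the view. -/
def DecidableLocally {I : Type} (proverFirst : Bool) (k : ℕ) (g : ℕ → ℝ)
    (L : DistributedLanguage I) : Prop :=
  ∀ c : ℕ, ∃ (t : ℕ) (s : ℕ → ℕ) (verifier : LocalView I k → Bool),
    (fun N => (s N : ℝ)) =O[atTop] g ∧
    ∀ (G : Network I) (ident : Fin G.size → ℕ),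
      Function.Injective ident → (∀ v, ident v ≤ G.size ^ c) →
        (G ∈ L ↔
          Alternating k proverFirst
            (fun l : Fin k → Fin G.size → BitString (s G.size) =>
              ∀ v, verifier (G.view ident l t v) = true))

/-- The class `Σ_k(g(n))` of the local decision hierarchy. -/
def SigmaLocal (I : Type) (k : ℕ) (g : ℕ → ℝ) : Set (DistributedLanguage I) :=
  {L | DecidableLocally true k g L}

/-- The class `Π_k(g(n))` of the local decision hierarchy. -/
def PiLocal (I : Type) (k : ℕ) (g : ℕ → ℝ) : Set (DistributedLanguage I) :=
  {L | DecidableLocally false k g L}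

/-- The class `Λ_k(g(n))`, in which the prover speaks last: `Σ_k` for odd `k`, `Π_k` for even
`k`. -/
def LambdaLocal (I : Type) (k : ℕ) (g : ℕ → ℝ) : Set (DistributedLanguage I) :=
  {L | (Odd k ∧ L ∈ SigmaLocal I k g) ∨ (Even k ∧ L ∈ PiLocal I k g)}

end LocalDecision

section Construction

/-- A map from graphs on `n` nodes to `n`-bit vectors, for every `n`, that depends only on the
isomorphism class and, as soon as `n` is large enough, attains every `n`-bit vector. -/
structure IsGraphEncoding (φ : (n : ℕ) → SimpleGraph (Fin n) → BitString n) : Prop where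
  iso_invariant : ∀ (n : ℕ) (H H' : SimpleGraph (Fin n)), Nonempty (H ≃g H') → φ n H = φ n H'
  surjective : ∀ᶠ n in atTop, Function.Surjective (φ n)

/-- The input of a node: it tells whether the node is Alice's endpoint, Bob's endpoint, or an
ordinary node. -/
inductive Mark : Type
  | plain
  | alice
  | bob

/-- Nodes: `V_A`, the path `v_1, …, v_{2t+1}` (indexed from `0`), and `V_B`. -/
abbrev GadgetVertex (n t : ℕ) : Type := Fin n ⊕ Fin (2 * t + 1) ⊕ Fin n

/-- The graph `HA` on `V_A` with all its nodes joined to the first node of the path, and the graph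
`HB` on `V_B` with all its nodes joined to the last node of the path. -/
def gadgetGraph (n t : ℕ) (HA HB : SimpleGraph (Fin n)) : SimpleGraph (GadgetVertex n t) where
  Adj
    | .inl a, .inl a' => HA.Adj a a'
    | .inl _, .inr (.inl i) => i.val = 0
    | .inr (.inl i), .inl _ => i.val = 0
    | .inr (.inl i), .inr (.inl j) => i.val + 1 = j.val ∨ j.val + 1 = i.val
    | .inr (.inl i), .inr (.inr _) => i.val = 2 * t
    | .inr (.inr _), .inr (.inl i) => i.val = 2 * t
    | .inr (.inr b), .inr (.inr b') => HB.Adj b b'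
    | .inl _, .inr (.inr _) => False
    | .inr (.inr _), .inl _ => False
  symm := ⟨by
    rintro (a | i | b) (a' | i' | b') h
    · exact HA.adj_symm h
    · exact h
    · exact h
    · exact h
    · exact Or.symm h
    · exact h
    · exact h
    · exact h
    · exact HB.adj_symm h⟩
  loopless := ⟨by
    rintro (a | i | b) h
    · exact HA.irrefl h
    · rcases h with h | h <;> omega
    · exact HB.irrefl h⟩

/-- The first node of the path is marked for Alice, the last one for Bob. -/
def gadgetInput (n t : ℕ) : GadgetVertex n t → Mark
  | .inr (.inl i) => if i.val = 0 then .alice else if i.val = 2 * t then .bob else .plain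
  | _ => .plain

/-- The language `L_f`: up to isomorphism, `G` is the graph built from a path with `2t+1 ≥ 3` nodes
and from graphs `HA`, `HB` on `n` nodes each, and `f` is `1` on the vectors that these encode. -/
def communicationLanguage (φ : (n : ℕ) → SimpleGraph (Fin n) → BitString n)
    (f : BooleanFunction) : DistributedLanguage Mark :=
  {G | ∃ (n t : ℕ) (HA HB : SimpleGraph (Fin n)), 1 ≤ t ∧
    (∃ e : G.graph ≃g gadgetGraph n t HA HB, ∀ v, G.input v = gadgetInput n t (e v)) ∧
    f n (φ n HA) (φ n HB) = true}

end Construction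

/-!
The map `φ` exists because there are at least `2 ^ (n choose 2) / n!` isomorphism classes of graphs
on `n` nodes, and this exceeds `2 ^ n` for `n ≥ 7` (`exists_isGraphEncoding`).

The verifier has radius one, so that Alice's node sees all of `V_A` and can compute `φ` of the graph
on it, and likewise for Bob. In the class `Λ_k` the prover speaks last, and his last label carries a
certificate: the parameters `n` and `t`, the identifier of Alice's node, the role of every node in
the gadget, and copies of the advice strings of all rounds. In the rounds before the last, only the
label of Alice's node counts; she compares it with the copies, and as neighbours compare their
copies with each other, Bob sees the same strings. These are the advice strings of the protocol.

The roles are checked locally as follows. Without the edges inside `V_A` and `V_B` the gadget is a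
tree, and each node checks that its tree edges lift uniquely to edges of the network. Only one
node has the role of Alice's node, because its identifier is part of the certificate. By
connectedness the roles are a bijection (`bijective_of_unique_lift`), and hence an isomorphism with
a gadget (`Network.exists_gadgetIso_of_accepts`). The converse is
`Network.exists_accepts_of_gadgetIso`.

In different plays the prover may use different isomorphisms, but the gadget determines the graphs on
`V_A` and `V_B` up to isomorphism (`nonempty_iso_of_gadgetIso`), and `φ` depends on nothing more. So
the two games agree at every position before the last move, and therefore have the same winner
(`alternating_iff_of_surjective`).

The certificate has a bounded number of fields of `O(max_{n ≤ N} s n + log N)` bits each, which is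
`O(g N)` because `g` is nondecreasing and `g n = Ω(log n)` (`fieldWidth_isBigO`).
-/

/-! ### Bit strings attained by isomorphism classes of graphs -/

theorem factorial_mul_two_pow_le {n : ℕ} (hn : 7 ≤ n) :
    n.factorial * 2 ^ n ≤ 2 ^ n.choose 2 := by
  induction n, hn using Nat.le_induction with
  | base => decide
  | succ n hn ih =>
    have h : 2 * (n + 1) ≤ 2 ^ n := by
      clear ih
      induction n, hn using Nat.le_induction with
      | base => norm_num
      | succ n hn ih => rw [pow_succ]; omega
    have hc : (n + 1).choose 2 = n + n.choose 2 := by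
      rw [Nat.choose_succ_succ' n 1, Nat.choose_one_right]
    rw [Nat.factorial_succ, hc, pow_succ]
    calc (n + 1) * n.factorial * (2 ^ n * 2)
        = (2 * (n + 1)) * (n.factorial * 2 ^ n) := by ring
      _ ≤ 2 ^ n * 2 ^ n.choose 2 := Nat.mul_le_mul h ih
      _ = 2 ^ (n + n.choose 2) := (pow_add _ _ _).symm

/-- Isomorphism of graphs on `n` nodes. -/
def graphIsoSetoid (n : ℕ) : Setoid (SimpleGraph (Fin n)) where
  r H H' := Nonempty (H ≃g H')
  iseqv := ⟨fun _ => ⟨.refl⟩, fun ⟨e⟩ => ⟨e.symm⟩, fun ⟨e⟩ ⟨e'⟩ => ⟨e.trans e'⟩⟩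

theorem two_pow_choose_two_le_card_simpleGraph (n : ℕ) :
    2 ^ n.choose 2 ≤ Nat.card (SimpleGraph (Fin n)) := by
  have hinj : Function.Injective
      (fun S : Set {e : Sym2 (Fin n) // ¬ e.IsDiag} =>
        SimpleGraph.fromEdgeSet (Subtype.val '' S)) := by
    intro S S' h
    have h' := congrArg SimpleGraph.edgeSet h
    have key : ∀ S : Set {e : Sym2 (Fin n) // ¬ e.IsDiag},
        (Subtype.val '' S) \ {e : Sym2 (Fin n) | e.IsDiag} = Subtype.val '' S := by
      intro S
      ext e
      constructor
      · exact fun h => h.1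
      · rintro ⟨x, hx, rfl⟩
        exact ⟨⟨x, hx, rfl⟩, x.2⟩
    simp only [SimpleGraph.edgeSet_fromEdgeSet] at h'
    have h'' : Subtype.val '' S = Subtype.val '' S' := by
      rw [← key S, ← key S']; exact h'
    exact Subtype.val_injective.image_injective h''
  have := Nat.card_le_card_of_injective _ hinj
  rw [Nat.card_eq_fintype_card, Fintype.card_set, Sym2.card_subtype_not_diag,
    Fintype.card_fin] at this
  exact this

/-- An isomorphism class has at most `n!` members, one for each permutation of the nodes. -/
theorem card_simpleGraph_le_card_quotient_mul_factorial (n : ℕ) :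
    Nat.card (SimpleGraph (Fin n)) ≤ Nat.card (Quotient (graphIsoSetoid n)) * n.factorial := by
  have hsurj : Function.Surjective
      (fun x : Quotient (graphIsoSetoid n) × Equiv.Perm (Fin n) => x.1.out.comap x.2) := by
    intro H
    obtain ⟨e⟩ : Nonempty (H ≃g (Quotient.mk (graphIsoSetoid n) H).out) :=
      (graphIsoSetoid n).symm (Quotient.mk_out H)
    refine ⟨(Quotient.mk _ H, e.toEquiv), ?_⟩
    ext u v
    exact e.map_adj_iff
  have := Nat.card_le_card_of_surjective _ hsurj
  rwa [Nat.card_prod, Nat.card_perm, Nat.card_eq_fintype_card (α := Fin n),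
    Fintype.card_fin] at this

theorem exists_isGraphEncoding :
    ∃ φ : (n : ℕ) → SimpleGraph (Fin n) → BitString n, IsGraphEncoding φ := by
  have key : ∀ n : ℕ, ∃ ψ : Quotient (graphIsoSetoid n) → BitString n,
      7 ≤ n → Function.Surjective ψ := by
    intro n
    by_cases hn : 7 ≤ n
    · have h1 := (factorial_mul_two_pow_le hn).trans ((two_pow_choose_two_le_card_simpleGraph n).trans
        (card_simpleGraph_le_card_quotient_mul_factorial n))
      rw [mul_comm] at h1
      have h2 : Nat.card (BitString n) ≤ Nat.card (Quotient (graphIsoSetoid n)) := by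
        simpa using Nat.le_of_mul_le_mul_right h1 n.factorial_pos
      have : Nonempty (BitString n ↪ Quotient (graphIsoSetoid n)) := by
        have := Fintype.ofFinite (Quotient (graphIsoSetoid n))
        rw [Nat.card_eq_fintype_card, Nat.card_eq_fintype_card] at h2
        exact Function.Embedding.nonempty_of_card_le h2
      obtain ⟨i⟩ := this
      exact ⟨Function.invFun i, fun _ => Function.invFun_surjective i.injective⟩
    · exact ⟨fun _ _ => false, fun h => absurd h hn⟩
  choose ψ hψ using key
  refine ⟨fun n H => ψ n (Quotient.mk _ H), ?_, ?_⟩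
  · intro n H H' h
    exact congrArg (ψ n) (Quotient.sound h)
  · filter_upwards [eventually_ge_atTop 7] with n hn
    exact (hψ n hn).comp Quotient.mk_surjective

/-! ### Alternating games whose last move is existential -/

theorem Alternating.not_of_forall_not {α : Type} [Nonempty α] {k : ℕ} {b : Bool}
    {P : (Fin k → α) → Prop} (h : ∀ l, ¬ P l) : ¬ Alternating k b P := by
  induction k generalizing b with
  | zero => exact h _
  | succ k ih =>
    cases b
    · intro hA
      exact ih (fun _ => h _) (hA (Classical.arbitrary α))
    · rintro ⟨a, ha⟩
      exact ih (fun _ => h _) ha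

/-- When the prover moves last, it is enough to compare two games at the positions before that
move, and earlier moves may be read through any surjection `π`. -/
theorem alternating_iff_of_surjective {α β : Type} {π : α → β} (hπ : Function.Surjective π)
    {k : ℕ} {b : Bool} (hb : b = true ↔ Even k) {P : (Fin (k + 1) → α) → Prop}
    {Q : (Fin (k + 1) → β) → Prop}
    (h : ∀ l : Fin k → α,
      (∃ a, P (Fin.snoc (α := fun _ => α) l a)) ↔
        ∃ c, Q (Fin.snoc (α := fun _ => β) (π ∘ l) c)) :
    Alternating (k + 1) b P ↔ Alternating (k + 1) b Q := by
  induction k generalizing b with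
  | zero =>
    obtain rfl : b = true := hb.2 Even.zero
    have h0 := h Fin.elim0
    have e1 : ∀ a : α, (Fin.cons (α := fun _ => α) a Fin.elim0 : Fin 1 → α) =
        Fin.snoc (α := fun _ => α) Fin.elim0 a := by
      intro a; funext i; obtain rfl : i = 0 := Fin.fin_one_eq_zero i; rfl
    have e2 : ∀ a : β, (Fin.cons (α := fun _ => β) a Fin.elim0 : Fin 1 → β) =
        Fin.snoc (α := fun _ => β) (π ∘ Fin.elim0) a := by
      intro a; funext i; obtain rfl : i = 0 := Fin.fin_one_eq_zero i; rfl
    simp only [Alternating, e1, e2]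
    exact h0
  | succ k ih =>
    have step : ∀ (a : α) (b' : Bool), (b' = true ↔ Even k) →
        (Alternating (k + 1) b' (fun l => P (Fin.cons (α := fun _ => α) a l)) ↔
          Alternating (k + 1) b' (fun l => Q (Fin.cons (α := fun _ => β) (π a) l))) := by
      intro a b' hb'
      refine ih hb' fun l => ?_
      have := h (Fin.cons (α := fun _ => α) a l)
      have e : (π ∘ Fin.cons (α := fun _ => α) a l : Fin (k + 1) → β) =
          Fin.cons (α := fun _ => β) (π a) (π ∘ l) := by
        funext i
        refine Fin.cases ?_ (fun j => ?_) i <;> simp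
      rw [e] at this
      simpa only [Fin.cons_snoc_eq_snoc_cons] using this
    cases b
    · have hk : Even k := by
        by_contra hk
        simpa using hb.2 (Nat.not_even_iff_odd.1 hk).add_one
      change (∀ a, _) ↔ (∀ a, _)
      constructor
      · intro H c
        obtain ⟨a, rfl⟩ := hπ c
        exact (step a true (by simpa using hk)).1 (H a)
      · intro H a
        exact (step a true (by simpa using hk)).2 (H (π a))
    · have hk : ¬ Even k := by
        rw [← Nat.even_add_one]; exact hb.1 rfl
      change (∃ a, _) ↔ (∃ a, _)
      constructor
      · rintro ⟨a, H⟩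
        exact ⟨π a, (step a false (by simpa using hk)).1 H⟩
      · rintro ⟨c, H⟩
        obtain ⟨a, rfl⟩ := hπ c
        exact ⟨a, (step a false (by simpa using hk)).2 H⟩

/-! ### Natural numbers packed into a label -/

/-- A list of `q * M` bits is read as `q` natural numbers of `M` bits each; this is the number with
index `i`. The width `M` is recovered from the length of the list, so that nothing but the list and
`q` is needed to read it. -/
def labelField (q : ℕ) (L : List Bool) (i : ℕ) : ℕ :=
  Nat.ofBits fun j : Fin (L.length / q) => L.getD (i * (L.length / q) + j) false

theorem exists_labelField_eq {q M : ℕ} (hq : 0 < q) (F : ℕ → ℕ) (hF : ∀ i < q, F i < 2 ^ M) :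
    ∃ b : BitString (q * M), ∀ i < q, labelField q (List.ofFn b) i = F i := by
  refine ⟨fun x => (F (x / M)).testBit (x % M), fun i hi => ?_⟩
  have hM : (List.ofFn fun x : Fin (q * M) => (F (x / M)).testBit (x % M)).length / q = M := by
    rw [List.length_ofFn, Nat.mul_div_cancel_left _ hq]
  unfold labelField
  apply Nat.eq_of_testBit_eq
  intro j
  rw [Nat.testBit_ofBits]
  by_cases hj : j < M
  · rw [dif_pos (hM.symm ▸ hj)]
    simp only [hM]
    have hlt : i * M + j < q * M := by
      calc i * M + j < (i + 1) * M := by rw [add_mul]; omega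
        _ ≤ q * M := Nat.mul_le_mul_right _ hi
    have hpos : 0 < M := by omega
    rw [List.getD_eq_getElem _ _ (by simpa using hlt), List.getElem_ofFn]
    have e1 : (i * M + j) / M = i := by
      rw [mul_comm, Nat.mul_add_div hpos, Nat.div_eq_of_lt hj, add_zero]
    have e2 : (i * M + j) % M = j := by
      rw [mul_comm, Nat.mul_add_mod, Nat.mod_eq_of_lt hj]
    simp only [e1, e2]
  · rw [dif_neg (hM.symm ▸ hj), eq_comm]
    exact Nat.testBit_lt_two_pow ((hF i hi).trans_le
      (Nat.pow_le_pow_right two_pos (not_lt.1 hj)))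

/-! ### The length of the labels -/

/-- The width of the numbers in a label: enough for the advice of all inputs of length at most `N`,
and for numbers up to `N`, up to `N ^ c`, and up to `2`. -/
def fieldWidth (s : ℕ → ℕ) (c N : ℕ) : ℕ :=
  (Finset.range (N + 1)).sup s + (c + 1) * (Nat.log 2 N + 1) + 2

theorem le_fieldWidth (s : ℕ → ℕ) (c : ℕ) {n N : ℕ} (h : n ≤ N) : s n ≤ fieldWidth s c N := by
  have := Finset.le_sup (f := s) (Finset.mem_range.2 (Nat.lt_add_one_of_le h))
  unfold fieldWidth
  omega

theorem pow_lt_two_pow_fieldWidth (s : ℕ → ℕ) (c N : ℕ) : N ^ c < 2 ^ fieldWidth s c N := by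
  have h1 : N ^ c ≤ 2 ^ ((Nat.log 2 N + 1) * c) := by
    rw [pow_mul]
    exact Nat.pow_le_pow_left (Nat.lt_pow_succ_log_self one_lt_two N).le c
  refine h1.trans_lt (Nat.pow_lt_pow_right one_lt_two ?_)
  unfold fieldWidth
  nlinarith [Nat.zero_le ((Finset.range (N + 1)).sup s)]

theorem lt_two_pow_fieldWidth (s : ℕ → ℕ) (c N : ℕ) : N < 2 ^ fieldWidth s c N := by
  refine (Nat.lt_pow_succ_log_self one_lt_two N).trans_le
    (Nat.pow_le_pow_right two_pos ?_)
  unfold fieldWidth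
  nlinarith [Nat.zero_le ((Finset.range (N + 1)).sup s), Nat.zero_le (c * (Nat.log 2 N + 1))]

theorem two_lt_two_pow_fieldWidth (s : ℕ → ℕ) (c N : ℕ) : 2 < 2 ^ fieldWidth s c N :=
  calc 2 < 2 ^ 2 := by norm_num
    _ ≤ _ := Nat.pow_le_pow_right two_pos (Nat.le_add_left _ _)

/-- Monotonicity of `g` turns the bound on `s n` into one on `s n` for all `n ≤ N`, and
`g n = Ω(log n)` absorbs the bits that identifiers and indices need. -/
theorem fieldWidth_isBigO {s : ℕ → ℕ} {g : ℕ → ℝ} (hg : Monotone g)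
    (hlog : (fun n : ℕ => Real.log (n : ℝ)) =O[atTop] g)
    (hs : (fun n => (s n : ℝ)) =O[atTop] g) (c : ℕ) :
    (fun N => (fieldWidth s c N : ℝ)) =O[atTop] g := by
  have hlogtop : Tendsto (fun n : ℕ => Real.log (n : ℝ)) atTop atTop :=
    Real.tendsto_log_atTop.comp tendsto_natCast_atTop_atTop
  have hone : ∀ K : ℝ, (fun _ : ℕ => K) =O[atTop] g := fun K =>
    (isLittleO_const_left.2 (Or.inr (tendsto_norm_atTop_atTop.comp hlogtop))).isBigO.trans hlog
  have hnatlog : (fun N : ℕ => (Nat.log 2 N : ℝ)) =O[atTop] g := by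
    refine IsBigO.trans (IsBigO.of_bound (1 / Real.log 2) ?_) hlog
    filter_upwards with N
    rw [Real.norm_natCast, Real.norm_of_nonneg (Real.log_natCast_nonneg N)]
    have := Real.natLog_le_logb N 2
    rw [Real.logb] at this
    calc (Nat.log 2 N : ℝ) ≤ _ := this
      _ = _ := by push_cast; ring
  -- `|g n|` is unbounded and `g` is bounded below by `g 0`, so `g` is eventually nonnegative.
  have hgtop : ∀ᶠ n in atTop, 0 ≤ g n := by
    obtain ⟨C, hC⟩ := hlog.bound
    have hb : ∀ᶠ n : ℕ in atTop, C * |g 0| < Real.log n := hlogtop.eventually_gt_atTop _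
    filter_upwards [hC, hb] with n h1 h2
    by_contra hneg
    push Not at hneg
    have h0 : g 0 ≤ g n := hg (Nat.zero_le n)
    have h3 : |g n| ≤ |g 0| := by
      rw [abs_of_neg hneg, abs_of_neg (h0.trans_lt hneg)]; linarith
    rw [Real.norm_of_nonneg (Real.log_natCast_nonneg n), Real.norm_eq_abs] at h1
    have hC0 : 0 ≤ C ∨ C < 0 := le_or_gt 0 C
    rcases hC0 with hC0 | hC0
    · nlinarith
    · nlinarith [Real.log_natCast_nonneg n, abs_pos_of_neg hneg]
  have hsup : (fun N => (((Finset.range (N + 1)).sup s : ℕ) : ℝ)) =O[atTop] g := by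
    obtain ⟨C, hCpos, hC⟩ := hs.exists_pos
    obtain ⟨n₀, hn₀⟩ := eventually_atTop.1 (hC.bound.and hgtop)
    -- The finitely many `n < n₀`, where `s n` is not bounded by `g n`, cost a constant `K`.
    set K := (Finset.range n₀).sup s
    have hbound : (fun N => (((Finset.range (N + 1)).sup s : ℕ) : ℝ)) =O[atTop]
        fun N => (K : ℝ) + C * g N := by
      refine IsBigO.of_bound 1 ?_
      filter_upwards [eventually_ge_atTop n₀] with N hN
      have hnn : 0 ≤ C * g N := mul_nonneg hCpos.le (hn₀ N hN).2
      rw [Real.norm_natCast, one_mul, Real.norm_of_nonneg (by positivity)]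
      obtain ⟨n, hn, hsn⟩ := Finset.exists_mem_eq_sup (Finset.range (N + 1)) ⟨0, by simp⟩ s
      rw [hsn]
      by_cases h : n < n₀
      · have : s n ≤ K := Finset.le_sup (f := s) (Finset.mem_range.2 h)
        have : (s n : ℝ) ≤ K := by exact_mod_cast this
        linarith
      · have h1 := hn₀ n (not_lt.1 h)
        rw [Real.norm_natCast, Real.norm_of_nonneg h1.2] at h1
        have h2 : g n ≤ g N := hg (Nat.lt_succ_iff.1 (Finset.mem_range.1 hn))
        have h3 : C * g n ≤ C * g N := mul_le_mul_of_nonneg_left h2 hCpos.le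
        have : (0 : ℝ) ≤ K := Nat.cast_nonneg _
        linarith [h1.1]
    exact hbound.trans ((hone K).add ((isBigO_refl g atTop).const_mul_left C))
  have := (hsup.add ((hnatlog.add (hone 1)).const_mul_left ((c : ℝ) + 1))).add (hone 2)
  refine this.congr_left fun N => ?_
  unfold fieldWidth
  push_cast
  ring

/-! ### The shape of the gadget -/

/-- Alice's node. -/
abbrev firstVertex (n t : ℕ) : GadgetVertex n t := .inr (.inl ⟨0, by omega⟩)

/-- Bob's node. -/
abbrev lastVertex (n t : ℕ) : GadgetVertex n t := .inr (.inl ⟨2 * t, by omega⟩)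

theorem gadgetInput_eq_alice_iff {n t : ℕ} {x : GadgetVertex n t} :
    gadgetInput n t x = .alice ↔ x = firstVertex n t := by
  rcases x with a | i | b
  · simp [gadgetInput]
  · simp only [gadgetInput, Sum.inr.injEq, Sum.inl.injEq, Fin.ext_iff]
    split_ifs <;> simp_all
  · simp [gadgetInput]

theorem gadgetInput_eq_bob_iff {n t : ℕ} (ht : 1 ≤ t) {x : GadgetVertex n t} :
    gadgetInput n t x = .bob ↔ x = lastVertex n t := by
  rcases x with a | i | b
  · simp [gadgetInput]
  · simp only [gadgetInput, Sum.inr.injEq, Sum.inl.injEq, Fin.ext_iff]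
    split_ifs with h1 h2
    · simp; omega
    · simpa using h2
    · simpa using h2
  · simp [gadgetInput]

theorem gadgetGraph_mono {n t : ℕ} {HA HA' HB HB' : SimpleGraph (Fin n)} (hA : HA ≤ HA')
    (hB : HB ≤ HB') : gadgetGraph n t HA HB ≤ gadgetGraph n t HA' HB' := by
  rintro (a | i | b) (a' | i' | b') h
  · exact hA h
  · exact h
  · exact h
  · exact h
  · exact h
  · exact h
  · exact h
  · exact h
  · exact hB h

/-- The mirror image of the gadget, with Alice's and Bob's sides exchanged. -/
def gadgetReverse (n t : ℕ) (HA HB : SimpleGraph (Fin n)) :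
    gadgetGraph n t HA HB ≃g gadgetGraph n t HB HA where
  toFun
    | .inl a => .inr (.inr a)
    | .inr (.inl i) => .inr (.inl i.rev)
    | .inr (.inr b) => .inl b
  invFun
    | .inl a => .inr (.inr a)
    | .inr (.inl i) => .inr (.inl i.rev)
    | .inr (.inr b) => .inl b
  left_inv := by rintro (a | i | b) <;> simp
  right_inv := by rintro (a | i | b) <;> simp
  map_rel_iff' := by
    rintro (a | i | b) (a' | i' | b') <;>
      simp only [gadgetGraph, Equiv.coe_fn_mk, Fin.val_rev] <;> omega

theorem gadgetReverse_firstVertex (n t : ℕ) (HA HB : SimpleGraph (Fin n)) :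
    gadgetReverse n t HA HB (firstVertex n t) = lastVertex n t := by
  simp [gadgetReverse, Fin.ext_iff]

theorem gadgetReverse_lastVertex (n t : ℕ) (HA HB : SimpleGraph (Fin n)) :
    gadgetReverse n t HA HB (lastVertex n t) = firstVertex n t := by
  simp [gadgetReverse, Fin.ext_iff]

section Rigidity

variable {n t n' t' : ℕ} {HA HB : SimpleGraph (Fin n)} {HA' HB' : SimpleGraph (Fin n')}

/-- If a node of `V_A` went to the second node of the path, then the whole path that leads from
there to Bob's node would come from `V_A`, because `V_A` can only be left through Alice's node. -/
theorem exists_inl_eq_of_gadgetIso (ht' : 1 ≤ t')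
    (ψ : gadgetGraph n t HA HB ≃g gadgetGraph n' t' HA' HB')
    (h0 : ψ (firstVertex n t) = firstVertex n' t') (h1 : ψ (lastVertex n t) = lastVertex n' t')
    (a : Fin n) : ∃ a', ψ (.inl a) = .inl a' := by
  have hadj : (gadgetGraph n' t' HA' HB').Adj (ψ (.inl a)) (firstVertex n' t') := by
    rw [← h0, ψ.map_adj_iff]
    rfl
  rcases hx : ψ (.inl a) with a' | i | b
  · exact ⟨a', rfl⟩
  · exfalso
    rw [hx] at hadj
    have hi : i.val = 1 := by
      rcases hadj with h | h <;> simp at h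
      omega
    have key : ∀ j : ℕ, ∀ hj : j + 1 < 2 * t' + 1, ∃ c : Fin n,
        ψ (.inl c) = .inr (.inl ⟨j + 1, hj⟩) := by
      intro j
      induction j with
      | zero =>
        intro hj
        refine ⟨a, ?_⟩
        rw [hx]
        congr 2
        exact Fin.ext hi
      | succ j ih =>
        intro hj
        obtain ⟨c, hc⟩ := ih (by omega)
        obtain ⟨y, hy⟩ := ψ.surjective (.inr (.inl ⟨j + 1 + 1, hj⟩))
        have hcy : (gadgetGraph n t HA HB).Adj (.inl c) y := by
          rw [← ψ.map_adj_iff, hc, hy]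
          exact Or.inl rfl
        rcases y with c' | i' | b'
        · exact ⟨c', hy⟩
        · have hi' : i' = ⟨0, by omega⟩ := Fin.ext hcy
          subst hi'
          rw [h0] at hy
          simp at hy
        · exact hcy.elim
    obtain ⟨c, hc⟩ := key (2 * t' - 1) (by omega)
    have : ψ (.inl c) = ψ (lastVertex n t) := by
      rw [hc, h1]
      congr 2
      exact Fin.ext (by simp; omega)
    simpa using ψ.injective this
  · rw [hx] at hadj
    have : 0 = 2 * t' := hadj
    omega

theorem nonempty_iso_left_of_gadgetIso (ht : 1 ≤ t) (ht' : 1 ≤ t')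
    (ψ : gadgetGraph n t HA HB ≃g gadgetGraph n' t' HA' HB')
    (h0 : ψ (firstVertex n t) = firstVertex n' t') (h1 : ψ (lastVertex n t) = lastVertex n' t') :
    Nonempty (HA ≃g HA') := by
  choose p hp using exists_inl_eq_of_gadgetIso ht' ψ h0 h1
  choose p' hp' using exists_inl_eq_of_gadgetIso ht ψ.symm
    (by rw [← h0, ψ.symm_apply_apply]) (by rw [← h1, ψ.symm_apply_apply])
  refine ⟨⟨⟨p, p', fun a => ?_, fun a => ?_⟩, fun {a b} => ?_⟩⟩
  · have h : (Sum.inl (p' (p a)) : GadgetVertex n t) = .inl a := by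
      rw [← hp', ← hp, ψ.symm_apply_apply]
    exact Sum.inl_injective h
  · have h : (Sum.inl (p (p' a)) : GadgetVertex n' t') = .inl a := by
      rw [← hp, ← hp', ψ.apply_symm_apply]
    exact Sum.inl_injective h
  · have := ψ.map_adj_iff (v := .inl a) (w := .inl b)
    rwa [hp, hp] at this

/-- The gadget determines the two graphs on its ends up to isomorphism. -/
theorem nonempty_iso_of_gadgetIso (ht : 1 ≤ t) (ht' : 1 ≤ t')
    (ψ : gadgetGraph n t HA HB ≃g gadgetGraph n' t' HA' HB')
    (hψ : ∀ x, gadgetInput n' t' (ψ x) = gadgetInput n t x) :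
    Nonempty (HA ≃g HA') ∧ Nonempty (HB ≃g HB') := by
  have h0 : ψ (firstVertex n t) = firstVertex n' t' := by
    rw [← gadgetInput_eq_alice_iff, hψ, gadgetInput_eq_alice_iff]
  have h1 : ψ (lastVertex n t) = lastVertex n' t' := by
    rw [← gadgetInput_eq_bob_iff ht', hψ, gadgetInput_eq_bob_iff ht]
  refine ⟨nonempty_iso_left_of_gadgetIso ht ht' ψ h0 h1,
    nonempty_iso_left_of_gadgetIso ht ht'
      (((gadgetReverse n t HB HA).trans ψ).trans (gadgetReverse n' t' HA' HB')) ?_ ?_⟩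
  · change gadgetReverse n' t' HA' HB' (ψ (gadgetReverse n t HB HA (firstVertex n t))) = _
    rw [gadgetReverse_firstVertex, h1, gadgetReverse_lastVertex]
  · change gadgetReverse n' t' HA' HB' (ψ (gadgetReverse n t HB HA (lastVertex n t))) = _
    rw [gadgetReverse_lastVertex, h0, gadgetReverse_firstVertex]

end Rigidity

/-! ### Recognizing the gadget by unique lifting of edges -/

/-- A map of graphs along which the edges of a connected graph lift uniquely is a bijection as soon
as one fibre has at most one element. -/
theorem bijective_of_unique_lift {V X : Type*} [Nonempty V] {G : SimpleGraph V}
    {T : SimpleGraph X} (hT : T.Connected) {R : V → X}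
    (hlift : ∀ v x, T.Adj (R v) x → ∃! w, G.Adj v w ∧ R w = x) {x₀ : X}
    (h₀ : ∀ u v, R u = x₀ → R v = x₀ → u = v) : Function.Bijective R := by
  have hsurj : Function.Surjective R := by
    intro x
    obtain ⟨v⟩ := ‹Nonempty V›
    obtain ⟨p⟩ := hT.preconnected (R v) x
    generalize hy : R v = y at p
    induction p generalizing v with
    | nil => exact ⟨v, hy⟩
    | cons h p ih =>
      subst hy
      obtain ⟨w, ⟨-, hw⟩, -⟩ := hlift v _ h
      exact ih w hw
  have huniq : ∀ x u v, R u = x → R v = x → u = v := by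
    intro x
    obtain ⟨p⟩ := hT.preconnected x₀ x
    induction p with
    | nil => exact h₀
    | @cons a b c h p ih =>
      refine ih fun u v hu hv => ?_
      obtain ⟨u', ⟨hu1, hu2⟩, -⟩ := hlift u a (hu.symm ▸ h.symm)
      obtain ⟨v', ⟨hv1, hv2⟩, -⟩ := hlift v a (hv.symm ▸ h.symm)
      obtain rfl := h₀ u' v' hu2 hv2
      exact (hlift u' b (hu2.symm ▸ h)).unique ⟨hu1.symm, hu⟩ ⟨hv1.symm, hv⟩
  exact ⟨fun u v h => huniq _ u v h rfl, hsurj⟩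

theorem gadgetGraph_bot_connected (n t : ℕ) : (gadgetGraph n t ⊥ ⊥).Connected := by
  have hpath : ∀ j : ℕ, ∀ hj : j < 2 * t + 1,
      (gadgetGraph n t ⊥ ⊥).Reachable (firstVertex n t) (.inr (.inl ⟨j, hj⟩)) := by
    intro j
    induction j with
    | zero => exact fun _ => .rfl
    | succ j ih =>
      intro hj
      refine (ih (by omega)).trans (SimpleGraph.Adj.reachable ?_)
      exact Or.inl rfl
  have hall : ∀ x, (gadgetGraph n t ⊥ ⊥).Reachable (firstVertex n t) x := by
    rintro (a | i | b)
    · exact SimpleGraph.Adj.reachable (by exact rfl)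
    · exact hpath i i.2
    · exact (hpath (2 * t) (by omega)).trans (SimpleGraph.Adj.reachable (by exact rfl))
  have : Nonempty (GadgetVertex n t) := ⟨firstVertex n t⟩
  exact ⟨fun x y => (hall x).symm.trans (hall y)⟩

/-- A bijection onto the nodes of the gadget is an isomorphism if it preserves adjacency, apart from
edges inside `V_A` and `V_B`, and if the graphs on `V_A` and `V_B` are read off from `G`. -/
noncomputable def gadgetIsoOfBijective {V : Type*} {G : SimpleGraph V} {n t : ℕ}
    {R : V → GadgetVertex n t}
    (hR : Function.Bijective R)
    (hhom : ∀ v w, G.Adj v w → (gadgetGraph n t ⊤ ⊤).Adj (R v) (R w))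
    (hlift : ∀ v w, (gadgetGraph n t ⊥ ⊥).Adj (R v) (R w) → G.Adj v w)
    {HA HB : SimpleGraph (Fin n)}
    (hA : ∀ v w i j, R v = .inl i → R w = .inl j → (HA.Adj i j ↔ G.Adj v w))
    (hB : ∀ v w i j, R v = .inr (.inr i) → R w = .inr (.inr j) → (HB.Adj i j ↔ G.Adj v w)) :
    G ≃g gadgetGraph n t HA HB where
  toEquiv := Equiv.ofBijective R hR
  map_rel_iff' := by
    intro v w
    have h1 := hhom v w
    have h2 := hlift v w
    have hA' := hA v w
    have hB' := hB v w
    rw [Equiv.ofBijective_apply, Equiv.ofBijective_apply]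
    generalize R v = x at *
    generalize R w = y at *
    rcases x with a | i | b <;> rcases y with a' | i' | b'
    · exact hA' _ _ rfl rfl
    · exact ⟨h2, h1⟩
    · exact ⟨h2, h1⟩
    · exact ⟨h2, h1⟩
    · exact ⟨h2, h1⟩
    · exact ⟨h2, h1⟩
    · exact ⟨h2, h1⟩
    · exact ⟨h2, h1⟩
    · exact hB' _ _ rfl rfl

/-! ### The verifier -/

/-- What a view says about one node: identifier, input and labels. -/
abbrev NodeRecord (k : ℕ) : Type := ℕ × Mark × (Fin (k + 1) → List Bool)

/-- The fields of the certificate that the prover writes into the last label. Fields `0`, `1`, `2`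
are the parameters `n`, `t` of the gadget and the identifier of Alice's node, fields `3`, `4`
describe the role of the node, and field `j + 5` is a copy of the `j`-th advice string. -/
def certField {k : ℕ} (p : NodeRecord k) (i : ℕ) : ℕ :=
  labelField (k + 6) (p.2.2 (Fin.last k)) i

/-- The role of a node in the gadget as a pair of numbers: the part it belongs to, and its index
there. -/
def roleCode {n t : ℕ} : GadgetVertex n t → ℕ × ℕ
  | .inl a => (0, a)
  | .inr (.inl i) => (1, i)
  | .inr (.inr b) => (2, b)

theorem roleCode_injective {n t : ℕ} : Function.Injective (roleCode (n := n) (t := t)) := by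
  rintro (a | i | b) (a' | i' | b') h <;> simp_all [roleCode, Fin.ext_iff]

/-- The code of the role that the prover assigns to a node. -/
def certRole {k : ℕ} (p : NodeRecord k) : ℕ × ℕ := (certField p 3, certField p 4)

/-- The advice strings for inputs of length `n` that are copied into the certificate. -/
def certAdvice {k : ℕ} (s : ℕ → ℕ) (p : NodeRecord k) (n : ℕ) : Fin (k + 1) → BitString (s n) :=
  fun j i => (certField p (j + 5)).testBit i

/-- The first `r` bits of a list, padded with `false` if the list is too short. -/
def firstBits (r : ℕ) (L : List Bool) : BitString r := fun i => L.getD i false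

/-- The records of the neighbours of the centre of a view. -/
def LocalView.neighbors {k : ℕ} (W : LocalView Mark (k + 1)) : Set (NodeRecord k) :=
  {q | q ∈ W.nodes ∧ (W.center, q.1) ∈ W.edges}

/-- The graph on `Fin n` formed by the visible nodes whose role belongs to the part `κ`. -/
def LocalView.partGraph {k : ℕ} (W : LocalView Mark (k + 1)) (n κ : ℕ) : SimpleGraph (Fin n) :=
  SimpleGraph.fromRel fun i j => ∃ p ∈ W.nodes, ∃ q ∈ W.nodes,
    certRole p = (κ, i.val) ∧ certRole q = (κ, j.val) ∧ (p.1, q.1) ∈ W.edges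

section Verifier

variable {k : ℕ} (φ : (n : ℕ) → SimpleGraph (Fin n) → BitString n) (s : ℕ → ℕ)
  (A B : (n : ℕ) → (Fin (k + 1) → BitString (s n)) → BitString n → Bool)

/-- The conditions under which a node with view `W` and record `p` accepts the role `x` in the
gadget with parameters `n` and `t`. -/
structure AcceptsRole (W : LocalView Mark (k + 1)) (p : NodeRecord k) (n t : ℕ)
    (x : GadgetVertex n t) : Prop where
  one_le : 1 ≤ t
  /-- All fields but the role are the same at all nodes. -/
  shared : ∀ q ∈ W.neighbors, ∀ i < k + 6, i ≠ 3 → i ≠ 4 → certField q i = certField p i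
  role : certRole p = roleCode x
  input : p.2.1 = gadgetInput n t x
  /-- The shared identifier prevents two nodes from both having the role of Alice's node. -/
  ident : x = firstVertex n t → p.1 = certField p 2
  hom : ∀ q ∈ W.neighbors, ∃ y, certRole q = roleCode y ∧ (gadgetGraph n t ⊤ ⊤).Adj x y
  lift : ∀ y, (gadgetGraph n t ⊥ ⊥).Adj x y → ∃! q, q ∈ W.neighbors ∧ certRole q = roleCode y
  /-- Alice's own labels are what counts as the advice of all rounds but the last. -/
  advice : x = firstVertex n t →
    ∀ j : Fin k, certAdvice s p n j.castSucc = firstBits (s n) (p.2.2 j.castSucc)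
  alice : x = firstVertex n t → A n (certAdvice s p n) (φ n (W.partGraph n 0)) = true
  bob : x = lastVertex n t → B n (certAdvice s p n) (φ n (W.partGraph n 2)) = true

open Classical in
/-- A node accepts if it accepts some role in the gadget whose parameters its certificate names. -/
noncomputable def gadgetVerifier (W : LocalView Mark (k + 1)) : Bool :=
  decide (∃ p ∈ W.nodes, p.1 = W.center ∧ ∃ x : GadgetVertex (certField p 0) (certField p 1),
    AcceptsRole φ s A B W p (certField p 0) (certField p 1) x)

end Verifier

section Network

variable {G : Network Mark} {ident : Fin G.size → ℕ} {k m : ℕ}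
  {l : Fin (k + 1) → Fin G.size → BitString m}

/-- The record of the node `u` in all views that contain it. -/
def Network.record (G : Network Mark) (ident : Fin G.size → ℕ)
    (l : Fin (k + 1) → Fin G.size → BitString m) (u : Fin G.size) : NodeRecord k :=
  (ident u, G.input u, fun j => List.ofFn (l j u))

theorem Network.dist_le_one_iff {u v : Fin G.size} :
    G.graph.dist v u ≤ 1 ↔ u = v ∨ G.graph.Adj v u := by
  rw [Nat.le_one_iff_eq_zero_or_eq_one, SimpleGraph.dist_eq_one_iff_adj,
    (G.connected v u).dist_eq_zero_iff, eq_comm]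

theorem Network.mem_neighbors_view (hid : Function.Injective ident) {v : Fin G.size}
    {q : NodeRecord k} :
    q ∈ (G.view ident l 1 v).neighbors ↔ ∃ w, G.graph.Adj v w ∧ q = G.record ident l w := by
  constructor
  · rintro ⟨⟨w, -, rfl⟩, u, w', -, -, hadj, h⟩
    obtain ⟨h1, h2⟩ := Prod.mk.inj h
    obtain rfl : v = u := hid h1
    obtain rfl : w = w' := hid h2
    exact ⟨w, hadj, rfl⟩
  · rintro ⟨w, hw, rfl⟩
    have hw1 := Network.dist_le_one_iff.2 (Or.inr hw)
    exact ⟨⟨w, hw1, rfl⟩, v, w, Network.dist_le_one_iff.2 (Or.inl rfl), hw1, hw, rfl⟩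

theorem Network.partGraph_view_adj (hid : Function.Injective ident)
    (hrole : Function.Injective fun u => certRole (G.record ident l u)) {n κ : ℕ} {i j : Fin n}
    {v u w : Fin G.size} (hu : G.graph.dist v u ≤ 1) (hw : G.graph.dist v w ≤ 1)
    (hui : certRole (G.record ident l u) = (κ, i.val))
    (hwj : certRole (G.record ident l w) = (κ, j.val)) :
    ((G.view ident l 1 v).partGraph n κ).Adj i j ↔ G.graph.Adj u w := by
  have key : ∀ {i j : Fin n} {u w : Fin G.size}, certRole (G.record ident l u) = (κ, i.val) →
      certRole (G.record ident l w) = (κ, j.val) →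
      (∃ p ∈ (G.view ident l 1 v).nodes, ∃ q ∈ (G.view ident l 1 v).nodes,
        certRole p = (κ, i.val) ∧ certRole q = (κ, j.val) ∧
          (p.1, q.1) ∈ (G.view ident l 1 v).edges) → G.graph.Adj u w := by
    rintro i j u w hui hwj ⟨_, ⟨u', -, rfl⟩, _, ⟨w', -, rfl⟩, hi, hj, u'', w'', -, -, hadj, h⟩
    obtain ⟨h1, h2⟩ := Prod.mk.inj h
    obtain rfl : u' = u'' := hid h1
    obtain rfl : w' = w'' := hid h2
    obtain rfl : u' = u := hrole (hi.trans hui.symm)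
    obtain rfl : w' = w := hrole (hj.trans hwj.symm)
    exact hadj
  rw [LocalView.partGraph, SimpleGraph.fromRel_adj]
  constructor
  · rintro ⟨-, h | h⟩
    · exact key hui hwj h
    · exact (key hwj hui h).symm
  · intro h
    refine ⟨?_, Or.inl ⟨_, ⟨u, hu, rfl⟩, _, ⟨w, hw, rfl⟩, hui, hwj, u, w, hu, hw, h, rfl⟩⟩
    rintro rfl
    exact h.ne (hrole (hui.trans hwj.symm))

theorem Network.gadgetVerifier_view (hid : Function.Injective ident)
    {φ : (n : ℕ) → SimpleGraph (Fin n) → BitString n} {s : ℕ → ℕ}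
    {A B : (n : ℕ) → (Fin (k + 1) → BitString (s n)) → BitString n → Bool} {v : Fin G.size} :
    gadgetVerifier φ s A B (G.view ident l 1 v) = true ↔
      ∃ x : GadgetVertex (certField (G.record ident l v) 0) (certField (G.record ident l v) 1),
        AcceptsRole φ s A B (G.view ident l 1 v) (G.record ident l v) _ _ x := by
  simp only [gadgetVerifier, decide_eq_true_eq]
  constructor
  · rintro ⟨_, ⟨u, -, rfl⟩, hu, h⟩
    obtain rfl : u = v := hid hu
    exact h
  · intro h
    exact ⟨_, ⟨v, Network.dist_le_one_iff.2 (Or.inl rfl), rfl⟩, rfl, h⟩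

/-- Soundness: if all nodes accept, then the network is a gadget, the copied advice agrees with the
labels of Alice's node, and both players accept it. -/
theorem Network.exists_gadgetIso_of_accepts (hid : Function.Injective ident)
    {φ : (n : ℕ) → SimpleGraph (Fin n) → BitString n} {s : ℕ → ℕ}
    {A B : (n : ℕ) → (Fin (k + 1) → BitString (s n)) → BitString n → Bool}
    (hacc : ∀ v, gadgetVerifier φ s A B (G.view ident l 1 v) = true) :
    ∃ (n t : ℕ) (HA HB : SimpleGraph (Fin n)) (e : G.graph ≃g gadgetGraph n t HA HB)
      (adv : Fin (k + 1) → BitString (s n)),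
      1 ≤ t ∧ (∀ v, G.input v = gadgetInput n t (e v)) ∧
      (∀ j : Fin k, adv j.castSucc =
        firstBits (s n) (List.ofFn (l j.castSucc (e.symm (firstVertex n t))))) ∧
      A n adv (φ n HA) = true ∧ B n adv (φ n HB) = true := by
  simp only [Network.gadgetVerifier_view hid] at hacc
  have hconst : ∀ i < k + 6, i ≠ 3 → i ≠ 4 → ∀ u v,
      certField (G.record ident l u) i = certField (G.record ident l v) i := by
    intro i hi h3 h4 u v
    obtain ⟨p⟩ := G.connected u v
    induction p with
    | nil => rfl
    | cons h p ih =>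
      obtain ⟨x, hx⟩ := hacc _
      exact (hx.shared _ ((Network.mem_neighbors_view hid).2 ⟨_, h, rfl⟩) i hi h3 h4).symm.trans ih
  obtain ⟨v₀⟩ := G.connected.nonempty
  obtain ⟨n, hn⟩ : ∃ n, ∀ v, certField (G.record ident l v) 0 = n :=
    ⟨_, fun v => hconst 0 (by omega) (by omega) (by omega) v v₀⟩
  obtain ⟨t, ht⟩ : ∃ t, ∀ v, certField (G.record ident l v) 1 = t :=
    ⟨_, fun v => hconst 1 (by omega) (by omega) (by omega) v v₀⟩
  have hacc' : ∀ v, ∃ x : GadgetVertex n t,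
      AcceptsRole φ s A B (G.view ident l 1 v) (G.record ident l v) n t x := by
    intro v
    have := hacc v
    rwa [hn v, ht v] at this
  choose R hR using hacc'
  have hhom : ∀ v w, G.graph.Adj v w → (gadgetGraph n t ⊤ ⊤).Adj (R v) (R w) := by
    intro v w h
    obtain ⟨y, hy, hadj⟩ := (hR v).hom _ ((Network.mem_neighbors_view hid).2 ⟨w, h, rfl⟩)
    rwa [roleCode_injective (hy.symm.trans (hR w).role)] at hadj
  have hcover : ∀ v x, (gadgetGraph n t ⊥ ⊥).Adj (R v) x →
      ∃! w, G.graph.Adj v w ∧ R w = x := by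
    intro v x h
    obtain ⟨q, ⟨hq, hqx⟩, huniq⟩ := (hR v).lift x h
    obtain ⟨w, hw, rfl⟩ := (Network.mem_neighbors_view hid).1 hq
    refine ⟨w, ⟨hw, roleCode_injective ((hR w).role.symm.trans hqx)⟩, ?_⟩
    rintro w' ⟨hw', rfl⟩
    have := huniq _ ⟨(Network.mem_neighbors_view hid).2 ⟨w', hw', rfl⟩, (hR w').role⟩
    exact hid (congrArg Prod.fst this)
  have : Nonempty (Fin G.size) := ⟨v₀⟩
  have hbij : Function.Bijective R :=
    bijective_of_unique_lift (gadgetGraph_bot_connected n t) hcover (x₀ := firstVertex n t)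
      fun u v hu hv => hid (((hR u).ident hu).trans
        ((hconst 2 (by omega) (by omega) (by omega) u v).trans ((hR v).ident hv).symm))
  have hlift : ∀ v w, (gadgetGraph n t ⊥ ⊥).Adj (R v) (R w) → G.graph.Adj v w := by
    intro v w h
    obtain ⟨w', ⟨hw', h'⟩, -⟩ := hcover v _ h
    rwa [hbij.1 h'] at hw'
  have hrole : Function.Injective fun u => certRole (G.record ident l u) := by
    intro u w h
    exact hbij.1 (roleCode_injective ((hR u).role.symm.trans (h.trans (hR w).role)))
  obtain ⟨a, ha⟩ := hbij.2 (firstVertex n t)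
  obtain ⟨b, hb⟩ := hbij.2 (lastVertex n t)
  have hclose : ∀ {v w : Fin G.size}, (gadgetGraph n t ⊥ ⊥).Adj (R v) (R w) →
      G.graph.dist v w ≤ 1 := fun h => Network.dist_le_one_iff.2 (Or.inr (hlift _ _ h))
  let e := gadgetIsoOfBijective hbij hhom hlift
    (HA := (G.view ident l 1 a).partGraph n 0) (HB := (G.view ident l 1 b).partGraph n 2)
    (by
      intro v w i j hv hw
      refine Network.partGraph_view_adj hid hrole (hclose ?_) (hclose ?_)
        (by rw [(hR v).role, hv]; rfl) (by rw [(hR w).role, hw]; rfl)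
      · rw [ha, hv]; rfl
      · rw [ha, hw]; rfl)
    (by
      intro v w i j hv hw
      refine Network.partGraph_view_adj hid hrole (hclose ?_) (hclose ?_)
        (by rw [(hR v).role, hv]; rfl) (by rw [(hR w).role, hw]; rfl)
      · rw [hb, hv]; rfl
      · rw [hb, hw]; rfl)
  have he : e.symm (firstVertex n t) = a := by
    rw [← ha]
    exact e.symm_apply_apply a
  have hadv : certAdvice s (G.record ident l b) n = certAdvice s (G.record ident l a) n := by
    funext j i
    rw [certAdvice, certAdvice, hconst (j + 5) (by omega) (by omega) (by omega) b a]
  refine ⟨n, t, _, _, e, certAdvice s (G.record ident l a) n, (hR v₀).one_le,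
    fun v => (hR v).input, ?_, (hR a).alice ha, ?_⟩
  · rw [he]
    exact (hR a).advice ha
  · rw [← hadv]
    exact (hR b).bob hb

/-- Completeness: on a gadget, advice that is accepted by both players yields a last label that is
accepted by all nodes. -/
theorem Network.exists_accepts_of_gadgetIso (hid : Function.Injective ident)
    {φ : (n : ℕ) → SimpleGraph (Fin n) → BitString n} {s : ℕ → ℕ}
    {A B : (n : ℕ) → (Fin (k + 1) → BitString (s n)) → BitString n → Bool}
    {n t M : ℕ} {HA HB : SimpleGraph (Fin n)} (ht : 1 ≤ t)
    (e : G.graph ≃g gadgetGraph n t HA HB) (hin : ∀ v, G.input v = gadgetInput n t (e v))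
    (hsM : s n ≤ M) (hsize : G.size < 2 ^ M) (hident : ∀ v, ident v < 2 ^ M) (hM : 2 < 2 ^ M)
    (l : Fin k → Fin G.size → BitString ((k + 6) * M)) (adv : Fin (k + 1) → BitString (s n))
    (hadv : ∀ j : Fin k, adv j.castSucc =
        firstBits (s n) (List.ofFn (l j (e.symm (firstVertex n t)))))
    (hA : A n adv (φ n HA) = true) (hB : B n adv (φ n HB) = true) :
    ∃ a : Fin G.size → BitString ((k + 6) * M), ∀ v, gadgetVerifier φ s A B
      (G.view ident (Fin.snoc (α := fun _ => Fin G.size → BitString ((k + 6) * M)) l a) 1 v) =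
        true := by
  have hcard : G.size = n + (2 * t + 1 + n) := by
    simpa using Fintype.card_congr e.toEquiv
  let F : Fin G.size → ℕ → ℕ := fun u i =>
    match i with
    | 0 => n
    | 1 => t
    | 2 => ident (e.symm (firstVertex n t))
    | 3 => (roleCode (e u)).1
    | 4 => (roleCode (e u)).2
    | i + 5 => if h : i < k + 1 then Nat.ofBits (adv ⟨i, h⟩) else 0
  have hF : ∀ u, ∀ i < k + 6, F u i < 2 ^ M := by
    intro u i hi
    match i with
    | 0 => change n < _; omega
    | 1 => change t < _; omega
    | 2 => exact hident _
    | 3 =>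
      change (roleCode (e u)).1 < _
      rcases e u with a | i | b <;> simp only [roleCode] <;> omega
    | 4 =>
      change (roleCode (e u)).2 < _
      rcases e u with a | i | b <;> simp only [roleCode] <;> omega
    | i + 5 =>
      change (if h : i < k + 1 then Nat.ofBits (adv ⟨i, h⟩) else 0) < _
      rw [dif_pos (by omega)]
      exact (Nat.ofBits_lt_two_pow _).trans_le (Nat.pow_le_pow_right two_pos hsM)
  -- The last label carries the role of the node under `e` and a copy of all advice strings.
  choose a ha using fun u => exists_labelField_eq (by omega) (F u) (hF u)
  refine ⟨a, fun v => (Network.gadgetVerifier_view hid).2 ?_⟩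
  set l' : Fin (k + 1) → Fin G.size → BitString ((k + 6) * M) :=
    Fin.snoc (α := fun _ => Fin G.size → BitString ((k + 6) * M)) l a with hl'
  have hfield : ∀ u, ∀ i < k + 6, certField (G.record ident l' u) i = F u i := by
    intro u i hi
    rw [← ha u i hi, certField, Network.record, hl']
    simp only [Fin.snoc_last]
  have h0 : certField (G.record ident l' v) 0 = n := hfield v 0 (by omega)
  have h1 : certField (G.record ident l' v) 1 = t := hfield v 1 (by omega)
  have hrole : ∀ u, certRole (G.record ident l' u) = roleCode (e u) := by
    intro u
    rw [certRole, hfield u 3 (by omega), hfield u 4 (by omega)]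
  have hroleinj : Function.Injective fun u => certRole (G.record ident l' u) := by
    intro u w h
    simp only [hrole] at h
    exact e.injective (roleCode_injective h)
  have hcertadv : certAdvice s (G.record ident l' v) n = adv := by
    funext j i
    rw [certAdvice, hfield v (j + 5) (by omega)]
    change (if h : (j : ℕ) < k + 1 then Nat.ofBits (adv ⟨j, h⟩) else 0).testBit i = _
    rw [dif_pos j.2, Nat.testBit_ofBits_lt _ _ i.2]
  have hclose : ∀ {u w : Fin G.size}, (gadgetGraph n t HA HB).Adj (e u) (e w) →
      G.graph.dist u w ≤ 1 := fun h => Network.dist_le_one_iff.2 (Or.inr (e.map_adj_iff.1 h))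
  rw [h0, h1]
  refine ⟨e v, ⟨ht, ?_, hrole v, hin v, ?_, ?_, ?_, ?_, ?_, ?_⟩⟩
  · intro q hq i hi h3 h4
    obtain ⟨w, -, rfl⟩ := (Network.mem_neighbors_view hid).1 hq
    rw [hfield w i hi, hfield v i hi]
    match i with
    | 0 => rfl
    | 1 => rfl
    | 2 => rfl
    | 3 => exact absurd rfl h3
    | 4 => exact absurd rfl h4
    | i + 5 => rfl
  · intro hv
    rw [hfield v 2 (by omega)]
    change ident v = ident (e.symm (firstVertex n t))
    rw [← hv, e.symm_apply_apply]
  · intro q hq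
    obtain ⟨w, hw, rfl⟩ := (Network.mem_neighbors_view hid).1 hq
    exact ⟨e w, hrole w, gadgetGraph_mono le_top le_top (e.map_adj_iff.2 hw)⟩
  · intro y hy
    have hvy : G.graph.Adj v (e.symm y) := by
      rw [← e.map_adj_iff, e.apply_symm_apply]
      exact gadgetGraph_mono bot_le bot_le hy
    refine ⟨G.record ident l' (e.symm y),
      ⟨(Network.mem_neighbors_view hid).2 ⟨_, hvy, rfl⟩, by rw [hrole, e.apply_symm_apply]⟩, ?_⟩
    rintro q ⟨hq, hqy⟩
    obtain ⟨w, hw, rfl⟩ := (Network.mem_neighbors_view hid).1 hq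
    rw [hrole] at hqy
    rw [← roleCode_injective hqy, e.symm_apply_apply]
  · intro hv j
    rw [hcertadv, hadv, ← hv, e.symm_apply_apply, Network.record, hl']
    simp only [Fin.snoc_castSucc]
  · intro hv
    rw [hcertadv]
    have : (G.view ident l' 1 v).partGraph n 0 = HA := by
      ext i j
      rw [Network.partGraph_view_adj hid hroleinj (u := e.symm (.inl i)) (w := e.symm (.inl j))
        (hclose ?_) (hclose ?_) (by rw [hrole, e.apply_symm_apply]; rfl)
        (by rw [hrole, e.apply_symm_apply]; rfl), ← e.map_adj_iff, e.apply_symm_apply,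
        e.apply_symm_apply]
      · rfl
      · rw [hv, e.apply_symm_apply]; rfl
      · rw [hv, e.apply_symm_apply]; rfl
    rw [this]
    exact hA
  · intro hv
    rw [hcertadv]
    have : (G.view ident l' 1 v).partGraph n 2 = HB := by
      ext i j
      rw [Network.partGraph_view_adj hid hroleinj (u := e.symm (.inr (.inr i)))
        (w := e.symm (.inr (.inr j)))
        (hclose ?_) (hclose ?_) (by rw [hrole, e.apply_symm_apply]; rfl)
        (by rw [hrole, e.apply_symm_apply]; rfl), ← e.map_adj_iff, e.apply_symm_apply,
        e.apply_symm_apply]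
      · rfl
      · rw [hv, e.apply_symm_apply]; rfl
      · rw [hv, e.apply_symm_apply]; rfl
    rw [this]
    exact hB

end Network

/-! ### From communication protocols to local decision -/

theorem firstBits_surjective {ι : Type} (i₀ : ι) {r m : ℕ} (h : r ≤ m) :
    Function.Surjective fun b : ι → BitString m => firstBits r (List.ofFn (b i₀)) := by
  intro c
  refine ⟨fun _ i => if hi : i.val < r then c ⟨i, hi⟩ else false, ?_⟩
  funext i
  have hi : i.val < m := i.2.trans_le h
  simp only [firstBits]
  rw [List.getD_eq_getElem _ _ (by simpa using hi), List.getElem_ofFn]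
  simp

/-- On a gadget, the game on labels is the game on advice strings: the label of Alice's node in each
round carries the advice string, and the last label copies all of them to Bob's node. -/
theorem alternating_gadgetVerifier_iff {φ : (n : ℕ) → SimpleGraph (Fin n) → BitString n}
    (hφ : ∀ (n : ℕ) (H H' : SimpleGraph (Fin n)), Nonempty (H ≃g H') → φ n H = φ n H')
    {k : ℕ} {b : Bool} (hb : b = true ↔ Even k) {s : ℕ → ℕ}
    {A B : (n : ℕ) → (Fin (k + 1) → BitString (s n)) → BitString n → Bool}
    {G : Network Mark} {ident : Fin G.size → ℕ} (hid : Function.Injective ident)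
    {n t M : ℕ} {HA HB : SimpleGraph (Fin n)} (ht : 1 ≤ t)
    (e : G.graph ≃g gadgetGraph n t HA HB) (hin : ∀ v, G.input v = gadgetInput n t (e v))
    (hsM : s n ≤ M) (hsize : G.size < 2 ^ M) (hident : ∀ v, ident v < 2 ^ M) (hM : 2 < 2 ^ M) :
    Alternating (k + 1) b (fun l : Fin (k + 1) → Fin G.size → BitString ((k + 6) * M) =>
        ∀ v, gadgetVerifier φ s A B (G.view ident l 1 v) = true) ↔
      Alternating (k + 1) b (fun l : Fin (k + 1) → BitString (s n) =>
        A n l (φ n HA) = true ∧ B n l (φ n HB) = true) := by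
  have hsurj := firstBits_surjective (e.symm (firstVertex n t))
    (hsM.trans (Nat.le_mul_of_pos_left M (show 0 < k + 6 by omega)))
  refine alternating_iff_of_surjective hsurj hb fun l => ⟨?_, ?_⟩
  · rintro ⟨a, ha⟩
    obtain ⟨n', t', HA', HB', e', adv, ht', hin', hadv, hA, hB⟩ :=
      Network.exists_gadgetIso_of_accepts hid ha
    -- The prover may have labelled `G` by another isomorphism than `e`; the encoded vectors and
    -- Alice's node are the same nevertheless.
    obtain ⟨hisoA, hisoB⟩ := nonempty_iso_of_gadgetIso ht ht' (e.symm.trans e') fun x => by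
      rw [← e.apply_symm_apply x, ← hin, e.apply_symm_apply]
      exact (hin' _).symm
    obtain rfl : n = n' := by
      obtain ⟨i⟩ := hisoA
      simpa using Fintype.card_congr i.toEquiv
    have hfirst : e'.symm (firstVertex n t') = e.symm (firstVertex n t) := by
      rw [← e.symm_apply_apply (e'.symm _)]
      congr 1
      rw [← gadgetInput_eq_alice_iff, ← hin, hin', e'.apply_symm_apply,
        gadgetInput_eq_alice_iff]
    have hadv' : Fin.snoc (α := fun _ => BitString (s n))
        ((fun b : Fin G.size → BitString ((k + 6) * M) =>
          firstBits (s n) (List.ofFn (b (e.symm (firstVertex n t))))) ∘ l)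
        (adv (Fin.last k)) = adv := by
      funext j
      refine Fin.lastCases ?_ (fun j => ?_) j
      · rw [Fin.snoc_last]
      · rw [Fin.snoc_castSucc, hadv, hfirst, Fin.snoc_castSucc]
        rfl
    refine ⟨adv (Fin.last k), ?_⟩
    rw [hadv', hφ n HA HA' hisoA, hφ n HB HB' hisoB]
    exact ⟨hA, hB⟩
  · rintro ⟨c, hA, hB⟩
    refine Network.exists_accepts_of_gadgetIso hid ht e hin hsM hsize hident hM l _ ?_ hA hB
    intro j
    rw [Fin.snoc_castSucc]
    rfl

theorem decidableLocally_communicationLanguage {φ : (n : ℕ) → SimpleGraph (Fin n) → BitString n}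
    (hφ : IsGraphEncoding φ) {k : ℕ} {b : Bool} (hb : b = true ↔ Even k) {g : ℕ → ℝ}
    (hg : Monotone g) (hlog : (fun n : ℕ => Real.log (n : ℝ)) =O[atTop] g) {f : BooleanFunction}
    (hf : DecidableCC b (k + 1) g f) :
    DecidableLocally b (k + 1) g (communicationLanguage φ f) := by
  obtain ⟨s, hs, A, B, hAB⟩ := hf
  intro c
  refine ⟨1, fun N => (k + 6) * fieldWidth s c N, gadgetVerifier φ s A B, ?_, ?_⟩
  · refine ((fieldWidth_isBigO hg hlog hs c).const_mul_left ((k : ℝ) + 6)).congr_left fun N => ?_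
    push_cast
    ring
  · intro G ident hid hbound
    have key : ∀ {n t : ℕ} {HA HB : SimpleGraph (Fin n)} (_ : 1 ≤ t)
        (e : G.graph ≃g gadgetGraph n t HA HB) (_ : ∀ v, G.input v = gadgetInput n t (e v)),
        Alternating (k + 1) b
            (fun l : Fin (k + 1) → Fin G.size → BitString ((k + 6) * fieldWidth s c G.size) =>
              ∀ v, gadgetVerifier φ s A B (G.view ident l 1 v) = true) ↔
          f n (φ n HA) (φ n HB) = true := by
      intro n t HA HB ht e hin
      have hcard : G.size = n + (2 * t + 1 + n) := by
        simpa using Fintype.card_congr e.toEquiv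
      rw [← hAB]
      exact alternating_gadgetVerifier_iff hφ.iso_invariant hb hid ht e hin
        (le_fieldWidth s c (by omega)) (lt_two_pow_fieldWidth s c _)
        (fun v => (hbound v).trans_lt (pow_lt_two_pow_fieldWidth s c _))
        (two_lt_two_pow_fieldWidth s c _)
    constructor
    · rintro ⟨n, t, HA, HB, ht, ⟨e, hin⟩, hf⟩
      exact (key ht e hin).2 hf
    · intro h
      by_contra hG
      refine Alternating.not_of_forall_not (fun l hl => hG ?_) h
      obtain ⟨n, t, HA, HB, e, -, ht, hin, -⟩ := Network.exists_gadgetIso_of_accepts hid hl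
      exact ⟨n, t, HA, HB, ht, ⟨e, hin⟩, (key ht e hin).1 h⟩

theorem mainTheorem5 (f : BooleanFunction) :
    ∃ L : DistributedLanguage Mark,
      (∃ φ : (n : ℕ) → SimpleGraph (Fin n) → BitString n,
        IsGraphEncoding φ ∧ L = communicationLanguage φ f) ∧
      ∀ (k : ℕ) (g : ℕ → ℝ), Monotone g →
        (fun n : ℕ => Real.log (n : ℝ)) =O[atTop] g →
        (Odd k ∧ f ∈ SigmaCC k g) ∨ (Even k ∧ 2 ≤ k ∧ f ∈ PiCC k g) →
          L ∈ LambdaLocal Mark k g := by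
  obtain ⟨φ, hφ⟩ := exists_isGraphEncoding
  refine ⟨_, ⟨φ, hφ, rfl⟩, ?_⟩
  rintro k g hg hlog (⟨hk, hf⟩ | ⟨hk, hk2, hf⟩)
  · obtain ⟨k, rfl⟩ : ∃ k', k = k' + 1 := ⟨k - 1, by have := hk.pos; omega⟩
    have hk' : Even k := Nat.not_odd_iff_even.1 (Nat.odd_add_one.1 hk)
    exact Or.inl ⟨hk, decidableLocally_communicationLanguage hφ (by simpa using hk') hg hlog hf⟩
  · obtain ⟨k, rfl⟩ : ∃ k', k = k' + 1 := ⟨k - 1, by omega⟩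
    have hk' : ¬ Even k := Nat.even_add_one.1 hk
    exact Or.inr ⟨hk, decidableLocally_communicationLanguage hφ (by simpa using hk') hg hlog hf⟩
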